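/- Graphs are finite, undirected and simple, with node features in $\mathbb{R}^d$; isomorphisms preserve adjacency and features. \textbf{Policies.} A node-based policy assigns to a graph $G=(V,E,x)$ a bag $(G^k)_{k\in V}$ of subgraphs, $G^k$ having connectivity $\sim_k$ induced by $G$ on a node set $V^k\subseteq V$. Let $\Pi$ consist of node deletion ($V^k=V\setminus\{k\}$), node marking ($V^k=V$), $h$-hop ego-networks EGO$(h)$ ($V^k$ the nodes at distance at most $h$ from $k$), and marked ego-networks EGO+$(h)$, for all $h>0$. Marking appends to the features a channel equal to $1$ at the root $k$ and $0$ at all other nodes. Write $x_i^k$ for the feature of node $i$ in $G^k$; nodes outside $V^k$ are kept as isolated nodes, and in sums over a bag below the range is, as a choice of the model, either all pairs $(k,i)$ or only those with $i\in V^k$. \textbf{Base-encoders.} An MPNN is a finite stacking of layers $x_i\mapsto\sigma\big(W_1x_i+W_2\sum_{j\sim i}x_j\big)$ with arbitrary weight matrices and entrywise activation $\sigma:\mathbb{R}\to\mathbb{R}$, or more generally of layers $x_i\mapsto U\big(x_i,\{\!\{x_j: j\sim i\}\!\}\big)$ with $U$ any function. MLPs alternate affine maps and entrywise activations. A DeepSets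 network is $\psi\big(\sum_k\phi(x^k)\big)$ with MLPs $\phi,\psi$, or $\psi\big(\sum_k z^k\big)$, where $z$ results from $x$ by finitely many layers $x^k\mapsto\sigma\big(W_1x^k+\sum_h W_2x^h\big)$. \textbf{Models.} The class $\Upsilon$ of known node-based Subgraph GNNs consists of the following. \begin{itemize} \item DS-GNN with any policy $\pi\in\Pi$: one MPNN is applied to every subgraph; then $x^k=\sum_i x^k_i$ and a DeepSets network is applied to $(x^k)_k$. The $(n-1)$-Reconstruction GNN is the case of node deletion. \item DSS-GNN with any $\pi\in\Pi$: the same readout after a stacking of layers $x^k\mapsto\gamma^0(G^k,x^k)+\gamma^1\big(G,\sum_h x^h\big)$ with MPNNs $\gamma^0,\gamma^1$, or $x^k_i\mapsto\sigma\big(W_1x^k_i+W_2\sum_{j\sim_k i}x^k_j+U_1\sum_h x^h_i+U_2\sum_{j\sim i}\sum_h x^h_j\big)$. \item GNN-AK and GNN-AK-ctx with EGO$(h)$: layers compute $h^k=\gamma(G^k,x^k)$ with an MPNN $\gamma$, and set $x^i_j$ to the sum or the concatenation of $h^j_j$ and $\sum_\ell h^j_\ell$, and for -ctx also $\sum_\ell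 h^\ell_j$. The output is $\mu\big(\sum_k x^k_k\big)$ with an MLP $\mu$. \item NGNN with EGO$(h)$: one MPNN is applied to every subgraph, then $x_k=\sum_i x^k_i$, then an MPNN on $G$; the output is $\mu$ of the sum over the nodes. \item ID-GNN with EGO+$(h)$: layers $x^k_i\mapsto\upsilon\big(x^k_i,\ \sum_{j\sim_k i,\,j\ne k}\mu_0(x^k_j)+\mathbf{1}[k\sim_k i]\,\mu_1(x^k_k)\big)$ with arbitrary functions $\upsilon,\mu_0,\mu_1$, in particular $\sigma\big(W_1x^k_i+W_2\sum_{j\sim_k i,\,j\neq k}x^k_j+\mathbf{1}[k\sim_k i]W_3x^k_k\big)$; the output is $\mu\big(\sum_k x^k_k\big)$. \end{itemize} \textbf{3-WL.} The test colours triples of nodes: initially by isomorphism type (equalities, adjacencies and features within the triple); in every round the colour of a triple is refined by the three multisets, one for each position, of the colours of the triples obtained by replacing the node in that position by each $w\in V$. It distinguishes two graphs if after some round the multisets of the colours of all triples differ. \textbf{Statement.} Let $G_1,G_2$ be non-isomorphic graphs and let $\mathcal{N}_\Theta$ be an instance, with weights $\Theta$, of a model in $\Upsilon$. If $\mathcal{N}_\Theta(G_1)\neq\mathcal{N}_\Theta(G_2)$,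 then the 3-WL test distinguishes $G_1$ and $G_2$. In other words, known node-based Subgraph GNNs are at most as expressive as 3-WL. -/

import Mathlib

namespace SubGNN

open Matrix

/-- A node-attributed undirected simple graph on `V`, with node features in `ℝ^d`. -/
structure AttrGraph (V : Type*) (d : ℕ) where
  graph : SimpleGraph V
  feat : V → Fin d → ℝ

/-- Isomorphism of attributed graphs: a graph isomorphism that preserves node features. -/
def AttrGraph.Isomorphic {V W : Type*} {d : ℕ} (G : AttrGraph V d) (H : AttrGraph W d) : Prop :=
  ∃ e : G.graph ≃g H.graph, ∀ i, H.feat (e i) = G.feat i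

/-! ### The `k`-dimensional Weisfeiler-Leman test -/

/-- Colours of `k`-tuples after `t` rounds.  Initially: the equality pattern, the adjacency pattern
and the node features of the tuple (its isomorphism type).  A refined colour is the old colour with,
for every position, the multiset of old colours of the tuples obtained by changing that position;
keeping these data themselves plays the role of an injective hash shared by all graphs. -/
def WLColor (k d : ℕ) : ℕ → Type
  | 0 => (Fin k → Fin k → Prop) × (Fin k → Fin k → Prop) × (Fin k → Fin d → ℝ)
  | t + 1 => WLColor k d t × (Fin k → Multiset (WLColor k d t))

def wlColor (k : ℕ) {V : Type*} [Fintype V] {d : ℕ} (G : AttrGraph V d) :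
    (t : ℕ) → (Fin k → V) → WLColor k d t
  | 0, v => (fun a b => v a = v b, fun a b => G.graph.Adj (v a) (v b), fun a => G.feat (v a))
  | t + 1, v => (wlColor k G t v, fun a =>
      (Finset.univ : Finset V).val.map fun w => wlColor k G t (Function.update v a w))

/-- `k`-WL distinguishes two graphs: after some number of rounds the multisets of colours of all
`k`-tuples differ. -/
def WLDistinguishes (k : ℕ) {V W : Type*} [Fintype V] [Fintype W] {d : ℕ}
    (G : AttrGraph V d) (H : AttrGraph W d) : Prop :=
  ∃ t : ℕ, (Finset.univ : Finset (Fin k → V)).val.map (wlColor k G t) ≠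
    (Finset.univ : Finset (Fin k → W)).val.map (wlColor k H t)

/-! ### Stackings and multi-layer perceptrons -/

/-- A stacking of finitely many layers, where `L d e` are the layers from width `d` to width `e`. -/
inductive Stack (L : ℕ → ℕ → Type) : ℕ → ℕ → Type
  | nil {d : ℕ} : Stack L d d
  | cons {d m e : ℕ} (l : L d m) (rest : Stack L m e) : Stack L d e

/-- Run a stacking, the first layer first. -/
def Stack.run {L : ℕ → ℕ → Type} {S : ℕ → Type*} (step : ∀ {d e : ℕ}, L d e → S d → S e) :
    {d e : ℕ} → Stack L d e → S d → S e
  | _, _, .nil, x => x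
  | _, _, .cons l rest, x => Stack.run (S := S) step rest (step l x)

/-- Multi-layer perceptrons: affine layers with entrywise activations between them. -/
inductive MLP : ℕ → ℕ → Type
  | output {d e : ℕ} (W : Matrix (Fin e) (Fin d) ℝ) (b : Fin e → ℝ) : MLP d e
  | hidden {d m e : ℕ} (σ : ℝ → ℝ) (W : Matrix (Fin m) (Fin d) ℝ) (b : Fin m → ℝ)
      (rest : MLP m e) : MLP d e

def MLP.eval : {d e : ℕ} → MLP d e → (Fin d → ℝ) → (Fin e → ℝ)
  | _, _, .output W b, x => W *ᵥ x + b
  | _, _, .hidden σ W b rest, x => rest.eval (σ ∘ (W *ᵥ x + b))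

/-! ### Message-passing base-encoders -/

open Classical in
/-- The neighbours of `i` in `H`. -/
noncomputable def nbrs {V : Type*} [Fintype V] (H : SimpleGraph V) (i : V) : Finset V :=
  Finset.univ.filter fun j => H.Adj i j

/-- Message-passing layers.  `morris σ W₁ W₂` has weight matrices `W₁`, `W₂` and entrywise
activation `σ`; `general` is an arbitrary update from a node's own feature and the multiset of its
neighbours' features. -/
inductive MPLayer (d e : ℕ) : Type
  | morris (σ : ℝ → ℝ) (W₁ W₂ : Matrix (Fin e) (Fin d) ℝ) : MPLayer d e
  | general (upd : (Fin d → ℝ) → Multiset (Fin d → ℝ) → (Fin e → ℝ)) : MPLayer d e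

noncomputable def MPLayer.apply {V : Type*} [Fintype V] {d e : ℕ} (l : MPLayer d e)
    (H : SimpleGraph V) (x : V → Fin d → ℝ) : V → Fin e → ℝ :=
  match l with
  | .morris σ W₁ W₂ => fun i => σ ∘ (W₁ *ᵥ x i + W₂ *ᵥ ∑ j ∈ nbrs H i, x j)
  | .general upd => fun i => upd (x i) ((nbrs H i).val.map x)

/-- Message-passing networks of any depth. -/
abbrev MPNN : ℕ → ℕ → Type := Stack MPLayer

noncomputable def MPNN.apply {V : Type*} [Fintype V] {d e : ℕ} (γ : MPNN d e)
    (H : SimpleGraph V) (x : V → Fin d → ℝ) : V → Fin e → ℝ :=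
  Stack.run (S := fun d => V → Fin d → ℝ) (fun l x => l.apply H x) γ x

/-! ### Node-based selection policies and bags of subgraphs -/

/-- The known node-based policies: node deletion, node marking, ego-networks of depth `h > 0`,
marked ego-networks of depth `h > 0`. -/
inductive Policy : Type
  | nodeDeletion
  | nodeMarking
  | ego (h : ℕ+)
  | egoPlus (h : ℕ+)

/-- Feature width after applying the policy: a mark occupies one additional channel. -/
def Policy.outDim : Policy → ℕ → ℕ
  | .nodeDeletion, d => d
  | .nodeMarking, d => d + 1
  | .ego _, d => d
  | .egoPlus _, d => d + 1

/-- The nodes within `h` hops of `k`. -/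
def ball {V : Type*} (H : SimpleGraph V) (h : ℕ) (k : V) : Set V :=
  {i | ∃ p : H.Walk k i, p.length ≤ h}

/-- The node set of the subgraph rooted at `k`. -/
def Policy.verts {V : Type*} (π : Policy) (H : SimpleGraph V) (k : V) : Set V :=
  match π with
  | .nodeDeletion => {i | i ≠ k}
  | .nodeMarking => Set.univ
  | .ego h => ball H h k
  | .egoPlus h => ball H h k

open Classical in
/-- `x` with one more channel, which is `1` at the root `k` and `0` at all other nodes. -/
noncomputable def mark {V : Type*} {d : ℕ} (x : V → Fin d → ℝ) (k i : V) : Fin (d + 1) → ℝ :=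
  Fin.snoc (α := fun _ => ℝ) (x i) (if i = k then 1 else 0)

/-- Feature of node `i` in the subgraph rooted at `k`. -/
noncomputable def Policy.feat {V : Type*} {d : ℕ} (π : Policy) (x : V → Fin d → ℝ) (k i : V) :
    Fin (π.outDim d) → ℝ :=
  match π with
  | .nodeDeletion => x i
  | .nodeMarking => mark x k i
  | .ego _ => x i
  | .egoPlus _ => mark x k i

/-- The subgraph induced on `s`, kept on the node set `V`: nodes outside `s` become isolated. -/
def restrict {V : Type*} (H : SimpleGraph V) (s : Set V) : SimpleGraph V where
  Adj i j := H.Adj i j ∧ i ∈ s ∧ j ∈ s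
  symm := ⟨fun _ _ h => ⟨h.1.symm, h.2.2, h.2.1⟩⟩
  loopless := ⟨fun _ h => h.1.ne rfl⟩

/-- A bag of subgraphs, one for every root in `V`, each stored on the node set `V`; `verts k` is
the set of nodes that belong to the subgraph rooted at `k`, `feat k i` the feature of node `i` in
that subgraph. -/
structure Bag (V : Type*) (d : ℕ) where
  verts : V → Set V
  graph : V → SimpleGraph V
  feat : V → V → Fin d → ℝ

noncomputable def Policy.bag {V : Type*} {d : ℕ} (π : Policy) (G : AttrGraph V d) :
    Bag V (π.outDim d) where
  verts k := π.verts G.graph k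
  graph k := restrict G.graph (π.verts G.graph k)
  feat k i := π.feat G.feat k i

/-- What the sums over a bag range over: all node-subgraph pairs (nodes outside a subgraph counting
as isolated nodes of it), or only the pairs where the node belongs to the subgraph. -/
inductive Scope : Type
  | all
  | members

def Scope.Mem {V : Type*} (s : Scope) (verts : V → Set V) (k i : V) : Prop :=
  match s with
  | .all => True
  | .members => i ∈ verts k

open Classical in
/-- The sum of the features of all nodes `i` of the subgraph rooted at `k`. -/
noncomputable def sumNodes {V : Type*} [Fintype V] {d : ℕ} (s : Scope) (verts : V → Set V)
    (x : V → V → Fin d → ℝ) (k : V) : Fin d → ℝ :=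
  ∑ i ∈ Finset.univ.filter (fun i => s.Mem verts k i), x k i

open Classical in
/-- The sum of the features of node `i` over all subgraphs `k`. -/
noncomputable def sumSubgraphs {V : Type*} [Fintype V] {d : ℕ} (s : Scope) (verts : V → Set V)
    (x : V → V → Fin d → ℝ) (i : V) : Fin d → ℝ :=
  ∑ k ∈ Finset.univ.filter (fun k => s.Mem verts k i), x k i

/-! ### Layers of the individual architectures -/

/-- Independent application of one message-passing network to every subgraph. -/
noncomputable def siamese {V : Type*} [Fintype V] {d e : ℕ} (γ : MPNN d e)
    (graph : V → SimpleGraph V) (x : V → V → Fin d → ℝ) : V → V → Fin e → ℝ :=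
  fun k => γ.apply (graph k) (x k)

/-- DSS-GNN layers: the sum of a siamese encoder and of an encoder that runs on the original graph
and the features aggregated across the bag; or the same with single layers whose contributions are
summed inside a common activation. -/
inductive DSSLayer (d e : ℕ) : Type
  | separate (γ₀ γ₁ : MPNN d e) : DSSLayer d e
  | fused (σ : ℝ → ℝ) (W₁ W₂ U₁ U₂ : Matrix (Fin e) (Fin d) ℝ) : DSSLayer d e

noncomputable def DSSLayer.apply {V : Type*} [Fintype V] {d e : ℕ} (l : DSSLayer d e) (s : Scope)
    (H : SimpleGraph V) (verts : V → Set V) (graph : V → SimpleGraph V)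
    (x : V → V → Fin d → ℝ) : V → V → Fin e → ℝ :=
  match l with
  | .separate γ₀ γ₁ => fun k i =>
      γ₀.apply (graph k) (x k) i + γ₁.apply H (sumSubgraphs s verts x) i
  | .fused σ W₁ W₂ U₁ U₂ => fun k i =>
      σ ∘ (W₁ *ᵥ x k i + W₂ *ᵥ ∑ j ∈ nbrs (graph k) i, x k j
        + U₁ *ᵥ sumSubgraphs s verts x i + U₂ *ᵥ ∑ j ∈ nbrs H i, sumSubgraphs s verts x j)

/-- GNN-AK layers: a siamese encoder followed by an aggregation of two terms, by summation or by
concatenation. -/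
inductive AKLayer : ℕ → ℕ → Type
  | sum {d e : ℕ} (γ : MPNN d e) : AKLayer d e
  | concat {d e : ℕ} (γ : MPNN d e) : AKLayer d (e + e)

noncomputable def AKLayer.apply {V : Type*} [Fintype V] (s : Scope) (verts : V → Set V)
    (graph : V → SimpleGraph V) :
    {d e : ℕ} → AKLayer d e → (V → V → Fin d → ℝ) → (V → V → Fin e → ℝ)
  | _, _, .sum γ, x => fun _ j =>
      siamese γ graph x j j + sumNodes s verts (siamese γ graph x) j
  | _, _, .concat γ, x => fun _ j =>
      Fin.append (siamese γ graph x j j) (sumNodes s verts (siamese γ graph x) j)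

/-- GNN-AK-ctx layers: as GNN-AK, with the sum across subgraphs as a third term. -/
inductive AKCtxLayer : ℕ → ℕ → Type
  | sum {d e : ℕ} (γ : MPNN d e) : AKCtxLayer d e
  | concat {d e : ℕ} (γ : MPNN d e) : AKCtxLayer d (e + e + e)

noncomputable def AKCtxLayer.apply {V : Type*} [Fintype V] (s : Scope) (verts : V → Set V)
    (graph : V → SimpleGraph V) :
    {d e : ℕ} → AKCtxLayer d e → (V → V → Fin d → ℝ) → (V → V → Fin e → ℝ)
  | _, _, .sum γ, x => fun _ j =>
      siamese γ graph x j j + sumNodes s verts (siamese γ graph x) j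
        + sumSubgraphs s verts (siamese γ graph x) j
  | _, _, .concat γ, x => fun _ j =>
      Fin.append (Fin.append (siamese γ graph x j j) (sumNodes s verts (siamese γ graph x) j))
        (sumSubgraphs s verts (siamese γ graph x) j)

/-- ID-GNN layers: heterogeneous message passing, where messages from the root are treated
differently from all others.  `general` has arbitrary update and message functions. -/
inductive IDLayer (d e : ℕ) : Type
  | morris (σ : ℝ → ℝ) (W₁ W₂ W₃ : Matrix (Fin e) (Fin d) ℝ) : IDLayer d e
  | general {m : ℕ} (upd : (Fin d → ℝ) → (Fin m → ℝ) → (Fin e → ℝ))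
      (μ₀ μ₁ : (Fin d → ℝ) → (Fin m → ℝ)) : IDLayer d e

open Classical in
noncomputable def IDLayer.apply {V : Type*} [Fintype V] {d e : ℕ} (l : IDLayer d e)
    (graph : V → SimpleGraph V) (x : V → V → Fin d → ℝ) : V → V → Fin e → ℝ :=
  match l with
  | .morris σ W₁ W₂ W₃ => fun k i =>
      σ ∘ (W₁ *ᵥ x k i + W₂ *ᵥ (∑ j ∈ (nbrs (graph k) i).filter (fun j => j ≠ k), x k j)
        + if (graph k).Adj k i then W₃ *ᵥ x k k else 0)
  | .general upd μ₀ μ₁ => fun k i =>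
      upd (x k i) ((∑ j ∈ (nbrs (graph k) i).filter (fun j => j ≠ k), μ₀ (x k j))
        + if (graph k).Adj k i then μ₁ (x k k) else 0)

/-! ### Readouts -/

/-- Equivariant layers on sets: `x k ↦ σ (W₁ x k + ∑ h, W₂ x h)`. -/
structure SetLayer (d e : ℕ) : Type where
  σ : ℝ → ℝ
  W₁ : Matrix (Fin e) (Fin d) ℝ
  W₂ : Matrix (Fin e) (Fin d) ℝ

def SetLayer.apply {V : Type*} [Fintype V] {d e : ℕ} (l : SetLayer d e) (x : V → Fin d → ℝ) :
    V → Fin e → ℝ :=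
  fun k => l.σ ∘ (l.W₁ *ᵥ x k + ∑ h, l.W₂ *ᵥ x h)

/-- Deep Sets networks, `ψ (∑ k, φ (x k))`, or with equivariant layers before the aggregation. -/
inductive DeepSets (d o : ℕ) : Type
  | early {e : ℕ} (φ : MLP d e) (ψ : MLP e o) : DeepSets d o
  | late {e : ℕ} (layers : Stack SetLayer d e) (ψ : MLP e o) : DeepSets d o

noncomputable def DeepSets.eval {V : Type*} [Fintype V] {d o : ℕ} (r : DeepSets d o)
    (x : V → Fin d → ℝ) : Fin o → ℝ :=
  match r with
  | .early φ ψ => ψ.eval (∑ k, φ.eval (x k))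
  | .late layers ψ =>
      ψ.eval (∑ k, Stack.run (S := fun d => V → Fin d → ℝ) (fun l x => l.apply x) layers x k)

/-! ### The class of known node-based Subgraph GNNs -/

/-- Instances (architecture, policy and weights) of the known node-based Subgraph GNNs, on graphs
with features in `ℝ^d` and with outputs in `ℝ^o`. -/
inductive Model (d o : ℕ) : Type
  /-- `(n-1)`-Reconstruction GNN -/
  | reconstruction {e : ℕ} (s : Scope) (S : MPNN (Policy.nodeDeletion.outDim d) e)
      (r : DeepSets e o) : Model d o
  /-- GNN-AK -/
  | gnnAK {e : ℕ} (h : ℕ+) (s : Scope) (S : Stack AKLayer ((Policy.ego h).outDim d) e)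
      (μ : MLP e o) : Model d o
  /-- GNN-AK-ctx -/
  | gnnAKCtx {e : ℕ} (h : ℕ+) (s : Scope) (S : Stack AKCtxLayer ((Policy.ego h).outDim d) e)
      (μ : MLP e o) : Model d o
  /-- NGNN; `γ` is the outer network on the original graph -/
  | ngnn {e m : ℕ} (h : ℕ+) (s : Scope) (S : MPNN ((Policy.ego h).outDim d) e) (γ : MPNN e m)
      (μ : MLP m o) : Model d o
  /-- ID-GNN; the depth `h` is often the number of layers, but may be any -/
  | idGNN {e : ℕ} (h : ℕ+) (S : Stack IDLayer ((Policy.egoPlus h).outDim d) e)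
      (μ : MLP e o) : Model d o
  /-- DS-GNN with policy `π` -/
  | dsGNN {e : ℕ} (π : Policy) (s : Scope) (S : MPNN (π.outDim d) e) (r : DeepSets e o) : Model d o
  /-- DSS-GNN with policy `π` -/
  | dssGNN {e : ℕ} (π : Policy) (s : Scope) (S : Stack DSSLayer (π.outDim d) e)
      (r : DeepSets e o) : Model d o

/-- Subgraph readout followed by a Deep Sets network, on the output features of a DS-GNN. -/
noncomputable def dsEval {V : Type*} [Fintype V] {d e o : ℕ} (s : Scope) (B : Bag V d)
    (S : MPNN d e) (r : DeepSets e o) : Fin o → ℝ :=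
  r.eval (sumNodes s B.verts (siamese S B.graph B.feat))

/-- The output of the instance on a graph. -/
noncomputable def Model.eval {V : Type*} [Fintype V] {d o : ℕ} (N : Model d o)
    (G : AttrGraph V d) : Fin o → ℝ :=
  match N with
  | .reconstruction s S r => dsEval s (Policy.nodeDeletion.bag G) S r
  | .gnnAK h s S μ =>
      let B := (Policy.ego h).bag G
      let x := Stack.run (S := fun d => V → V → Fin d → ℝ)
        (fun l x => l.apply s B.verts B.graph x) S B.feat
      μ.eval (∑ k, x k k)
  | .gnnAKCtx h s S μ =>
      let B := (Policy.ego h).bag G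
      let x := Stack.run (S := fun d => V → V → Fin d → ℝ)
        (fun l x => l.apply s B.verts B.graph x) S B.feat
      μ.eval (∑ k, x k k)
  | .ngnn h s S γ μ =>
      let B := (Policy.ego h).bag G
      let y := sumNodes s B.verts (siamese S B.graph B.feat)
      μ.eval (∑ k, γ.apply G.graph y k)
  | .idGNN h S μ =>
      let B := (Policy.egoPlus h).bag G
      let x := Stack.run (S := fun d => V → V → Fin d → ℝ)
        (fun l x => l.apply B.graph x) S B.feat
      μ.eval (∑ k, x k k)
  | .dsGNN π s S r => dsEval s (π.bag G) S r
  | .dssGNN π s S r =>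
      let B := π.bag G
      let x := Stack.run (S := fun d => V → V → Fin d → ℝ)
        (fun l x => l.apply s G.graph B.verts B.graph x) S B.feat
      r.eval (sumNodes s B.verts x)

/-- The instance assigns different outputs to the two graphs. -/
def Model.Distinguishes {V W : Type*} [Fintype V] [Fintype W] {d o : ℕ} (N : Model d o)
    (G : AttrGraph V d) (H : AttrGraph W d) : Prop :=
  N.eval G ≠ N.eval H

end SubGNN

namespace SubGNN

open Matrix

/-! ### Bijections from equal multisets -/

theorem exists_equiv_of_map_univ_eq {α β γ : Type*} [Fintype α] [Fintype β] {f : α → γ} {g : β → γ}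
    (h : (Finset.univ : Finset α).val.map f = (Finset.univ : Finset β).val.map g) :
    ∃ e : α ≃ β, ∀ a, g (e a) = f a := by
  classical
  -- The multiplicity of `c` is the size of its fibre, so fibres over the same colour are
  -- equinumerous and can be matched one by one.
  have hc (c : γ) : Nonempty ({a // f a = c} ≃ {b // g b = c}) := by
    have := congrArg (Multiset.count c) h
    simp only [Multiset.count_map] at this
    refine ⟨Fintype.equivOfCardEq ?_⟩
    rw [Fintype.card_subtype, Fintype.card_subtype]
    simpa [Finset.card_def, eq_comm] using this
  exact ⟨Equiv.ofFiberEquiv fun c => (hc c).some, Equiv.ofFiberEquiv_map _⟩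

/-! ### The stable colouring as a bisimulation on pairs of nodes -/

section Bisimulation

variable {V₁ V₂ : Type*} [Fintype V₁] [Fintype V₂] {d : ℕ}

theorem wlColor_eq_of_le {k : ℕ} {G₁ : AttrGraph V₁ d} {G₂ : AttrGraph V₂ d} {v : Fin k → V₁}
    {w : Fin k → V₂} {s t : ℕ} (hst : s ≤ t) (h : wlColor k G₁ t v = wlColor k G₂ t w) :
    wlColor k G₁ s v = wlColor k G₂ s w := by
  induction hst with
  | refl => exact h
  | step _ ih => exact ih (congrArg Prod.fst h)

/-- From some round on, tuples of equal colour keep equal colours forever. -/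
theorem exists_stable_round {k : ℕ} (G₁ : AttrGraph V₁ d) (G₂ : AttrGraph V₂ d) :
    ∃ T, ∀ v w, wlColor k G₁ T v = wlColor k G₂ T w → ∀ t, wlColor k G₁ t v = wlColor k G₂ t w := by
  classical
  -- Each pair of tuples that is ever separated has a separating round. There are finitely many
  -- pairs, so the largest of these rounds serves all.
  have key (p : (Fin k → V₁) × (Fin k → V₂)) :
      ∃ n, wlColor k G₁ n p.1 = wlColor k G₂ n p.2 → ∀ t, wlColor k G₁ t p.1 = wlColor k G₂ t p.2 := by
    by_cases h : ∀ t, wlColor k G₁ t p.1 = wlColor k G₂ t p.2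
    · exact ⟨0, fun _ => h⟩
    · push Not at h
      obtain ⟨n, hn⟩ := h
      exact ⟨n, fun h => absurd h hn⟩
  choose n hn using key
  exact ⟨Finset.univ.sup n, fun v w h =>
    hn (v, w) (wlColor_eq_of_le (Finset.le_sup (Finset.mem_univ (v, w))) h)⟩

/-- Two tuples receive the same colour in every round. -/
def SameColor {k : ℕ} (G₁ : AttrGraph V₁ d) (G₂ : AttrGraph V₂ d) (v : Fin k → V₁)
    (w : Fin k → V₂) : Prop :=
  ∀ t, wlColor k G₁ t v = wlColor k G₂ t w

/-- Round `T + 1` only gives a bijection matching colours of round `T`. Choosing `T` stable makes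
this single bijection valid for all rounds. -/
theorem SameColor.exists_equiv {k : ℕ} {G₁ : AttrGraph V₁ d} {G₂ : AttrGraph V₂ d} {v : Fin k → V₁}
    {w : Fin k → V₂} (h : SameColor G₁ G₂ v w) (a : Fin k) :
    ∃ e : V₁ ≃ V₂, ∀ j, SameColor G₁ G₂ (Function.update v a j) (Function.update w a (e j)) := by
  obtain ⟨T, hT⟩ := exists_stable_round (k := k) G₁ G₂
  obtain ⟨e, he⟩ := exists_equiv_of_map_univ_eq (congrFun (congrArg Prod.snd (h (T + 1))) a)
  exact ⟨e, fun j => hT _ _ (he j).symm⟩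

theorem SameColor.eq_iff {k : ℕ} {G₁ : AttrGraph V₁ d} {G₂ : AttrGraph V₂ d} {v : Fin k → V₁}
    {w : Fin k → V₂} (h : SameColor G₁ G₂ v w) (a b : Fin k) : v a = v b ↔ w a = w b :=
  iff_of_eq (congrFun (congrFun (congrArg Prod.fst (h 0)) a) b)

theorem SameColor.adj_iff {k : ℕ} {G₁ : AttrGraph V₁ d} {G₂ : AttrGraph V₂ d} {v : Fin k → V₁}
    {w : Fin k → V₂} (h : SameColor G₁ G₂ v w) (a b : Fin k) :
    G₁.graph.Adj (v a) (v b) ↔ G₂.graph.Adj (w a) (w b) :=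
  iff_of_eq (congrFun (congrFun (congrArg (fun c => c.2.1) (h 0)) a) b)

theorem SameColor.feat_eq {k : ℕ} {G₁ : AttrGraph V₁ d} {G₂ : AttrGraph V₂ d} {v : Fin k → V₁}
    {w : Fin k → V₂} (h : SameColor G₁ G₂ v w) (a : Fin k) : G₁.feat (v a) = G₂.feat (w a) :=
  congrFun (congrArg (fun c => c.2.2) (h 0)) a

theorem exists_equiv_sameColor {k : ℕ} {G₁ : AttrGraph V₁ d} {G₂ : AttrGraph V₂ d}
    (h : ¬ WLDistinguishes k G₁ G₂) :
    ∃ E : (Fin k → V₁) ≃ (Fin k → V₂), ∀ v, SameColor G₁ G₂ v (E v) := by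
  obtain ⟨T, hT⟩ := exists_stable_round (k := k) G₁ G₂
  simp only [WLDistinguishes, not_exists, not_not] at h
  obtain ⟨E, hE⟩ := exists_equiv_of_map_univ_eq (h T)
  exact ⟨E, fun v => hT _ _ (hE v).symm⟩

/-- Constant tuples correspond to constant tuples. -/
theorem exists_equiv_sameColor_const {k : ℕ} [NeZero k] {G₁ : AttrGraph V₁ d} {G₂ : AttrGraph V₂ d}
    (h : ¬ WLDistinguishes k G₁ G₂) :
    ∃ e : V₁ ≃ V₂, ∀ i, SameColor G₁ G₂ (Function.const (Fin k) i) (Function.const (Fin k) (e i)) := by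
  obtain ⟨E, hE⟩ := exists_equiv_sameColor h
  -- The round-0 colour records the equality pattern, so the partner of a constant tuple is
  -- constant.
  have h₁ (i : V₁) : Function.const (Fin k) (E (Function.const _ i) 0) = E (Function.const _ i) :=
    funext fun a => ((hE (Function.const _ i)).eq_iff 0 a).1 rfl
  have h₂ (i : V₂) : Function.const (Fin k) (E.symm (Function.const _ i) 0)
      = E.symm (Function.const _ i) :=
    funext fun a => ((hE (E.symm (Function.const _ i))).eq_iff 0 a).2 (by simp)
  refine ⟨⟨fun i => E (Function.const _ i) 0, fun i => E.symm (Function.const _ i) 0,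
    fun i => ?_, fun i => ?_⟩, fun i => ?_⟩
  · simp [h₁]
  · simp [h₂]
  · simpa [h₁] using hE (Function.const _ i)

/-- Pairs of nodes that can be completed to triples of the same stable colour. -/
def PairRel (G₁ : AttrGraph V₁ d) (G₂ : AttrGraph V₂ d) (k i : V₁) (k' i' : V₂) : Prop :=
  ∃ v w, SameColor (k := 3) G₁ G₂ v w ∧ ∃ a b, v a = k ∧ v b = i ∧ w a = k' ∧ w b = i'

variable {G₁ : AttrGraph V₁ d} {G₂ : AttrGraph V₂ d} {k i j : V₁} {k' i' j' : V₂}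

namespace PairRel

theorem swap : PairRel G₁ G₂ k i k' i' → PairRel G₁ G₂ i k i' k'
  | ⟨v, w, h, a, b, h₁, h₂, h₃, h₄⟩ => ⟨v, w, h, b, a, h₂, h₁, h₄, h₃⟩

/-- The positions `a` and `b` in `PairRel` may coincide, so diagonal pairs need no separate
treatment. -/
theorem left : PairRel G₁ G₂ k i k' i' → PairRel G₁ G₂ k k k' k'
  | ⟨v, w, h, a, _, h₁, _, h₃, _⟩ => ⟨v, w, h, a, a, h₁, h₁, h₃, h₃⟩

theorem right (h : PairRel G₁ G₂ k i k' i') : PairRel G₁ G₂ i i i' i' := h.swap.left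

theorem eq_iff : PairRel G₁ G₂ k i k' i' → (k = i ↔ k' = i') := by
  rintro ⟨v, w, h, a, b, rfl, rfl, rfl, rfl⟩
  exact h.eq_iff a b

theorem adj_iff : PairRel G₁ G₂ k i k' i' → (G₁.graph.Adj k i ↔ G₂.graph.Adj k' i') := by
  rintro ⟨v, w, h, a, b, rfl, rfl, rfl, rfl⟩
  exact h.adj_iff a b

theorem feat_eq : PairRel G₁ G₂ k i k' i' → G₁.feat k = G₂.feat k' := by
  rintro ⟨v, w, h, a, b, rfl, rfl, rfl, rfl⟩
  exact h.feat_eq a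

/-- This is where dimension 3 is used: a pair occupies at most two positions, which leaves a third
one free to be varied over all nodes. -/
theorem extend : PairRel G₁ G₂ k i k' i' →
    ∃ e : V₁ ≃ V₂, ∀ j, PairRel G₁ G₂ k j k' (e j) ∧ PairRel G₁ G₂ i j i' (e j) := by
  rintro ⟨v, w, h, a, b, rfl, rfl, rfl, rfl⟩
  obtain ⟨c, ha, hb⟩ : ∃ c : Fin 3, a ≠ c ∧ b ≠ c := by
    revert a b; decide
  obtain ⟨e, he⟩ := h.exists_equiv c
  exact ⟨e, fun j => ⟨⟨_, _, he j, a, c, by simp [ha], by simp, by simp [ha], by simp⟩,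
    ⟨_, _, he j, b, c, by simp [hb], by simp, by simp [hb], by simp⟩⟩⟩

/-- The failure of 3-WL to separate the graphs affects the models only through this matching of
roots. Everything else is local to related pairs. -/
theorem exists_root_equiv (h : ¬ WLDistinguishes 3 G₁ G₂) :
    ∃ e : V₁ ≃ V₂, ∀ k, PairRel G₁ G₂ k k (e k) (e k) := by
  obtain ⟨e, he⟩ := exists_equiv_sameColor_const h
  exact ⟨e, fun k => ⟨_, _, he k, 0, 0, rfl, rfl, rfl, rfl⟩⟩

end PairRel

/-! ### Features, node sets and graph families that respect the bisimulation -/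

/-- Pair features that agree on related pairs. -/
def Agree {α : Sort*} (G₁ : AttrGraph V₁ d) (G₂ : AttrGraph V₂ d) (x₁ : V₁ → V₁ → α)
    (x₂ : V₂ → V₂ → α) : Prop :=
  ∀ ⦃k i k' i'⦄, PairRel G₁ G₂ k i k' i' → x₁ k i = x₂ k' i'

/-- Node features that agree on related nodes. -/
def NodeAgree {α : Sort*} (G₁ : AttrGraph V₁ d) (G₂ : AttrGraph V₂ d) (y₁ : V₁ → α)
    (y₂ : V₂ → α) : Prop :=
  ∀ ⦃k k'⦄, PairRel G₁ G₂ k k k' k' → y₁ k = y₂ k'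

/-- Families of rooted graphs whose adjacencies agree on related triples. -/
def GraphAgree (G₁ : AttrGraph V₁ d) (G₂ : AttrGraph V₂ d) (g₁ : V₁ → SimpleGraph V₁)
    (g₂ : V₂ → SimpleGraph V₂) : Prop :=
  ∀ ⦃k i j k' i' j'⦄, PairRel G₁ G₂ k i k' i' → PairRel G₁ G₂ k j k' j' →
    PairRel G₁ G₂ i j i' j' → ((g₁ k).Adj i j ↔ (g₂ k').Adj i' j')

/-- Node sets of a bag that agree on related pairs. -/
def VertsAgree (G₁ : AttrGraph V₁ d) (G₂ : AttrGraph V₂ d) (s₁ : V₁ → Set V₁)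
    (s₂ : V₂ → Set V₂) : Prop :=
  ∀ ⦃k i k' i'⦄, PairRel G₁ G₂ k i k' i' → (i ∈ s₁ k ↔ i' ∈ s₂ k')

/-- Node features become pair features that ignore the root, so results on bags also cover message
passing on the original graph. -/
theorem NodeAgree.agree_right {α : Sort*} {y₁ : V₁ → α} {y₂ : V₂ → α} (h : NodeAgree G₁ G₂ y₁ y₂) :
    Agree G₁ G₂ (fun _ i => y₁ i) (fun _ i => y₂ i) :=
  fun _ _ _ _ p => h p.right

theorem Agree.diag {α : Sort*} {x₁ : V₁ → V₁ → α} {x₂ : V₂ → V₂ → α} (h : Agree G₁ G₂ x₁ x₂) :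
    NodeAgree G₁ G₂ (fun k => x₁ k k) (fun k => x₂ k k) :=
  fun _ _ p => h p

theorem graphAgree_const : GraphAgree G₁ G₂ (fun _ => G₁.graph) (fun _ => G₂.graph) :=
  fun _ _ _ _ _ _ _ _ h => h.adj_iff

theorem GraphAgree.restrict {s₁ : V₁ → Set V₁} {s₂ : V₂ → Set V₂} (hs : VertsAgree G₁ G₂ s₁ s₂) :
    GraphAgree G₁ G₂ (fun k => restrict G₁.graph (s₁ k)) (fun k => restrict G₂.graph (s₂ k)) :=
  fun _ _ _ _ _ _ hi hj hij => and_congr hij.adj_iff (and_congr (hs hi) (hs hj))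

theorem mem_ball_succ {V : Type*} {H : SimpleGraph V} {h : ℕ} {k i : V} :
    i ∈ ball H (h + 1) k ↔ i ∈ ball H h k ∨ ∃ j, j ∈ ball H h k ∧ H.Adj j i := by
  constructor
  · rintro ⟨p, hp⟩
    by_cases hl : p.length ≤ h
    · exact .inl ⟨p, hl⟩
    · have hn : ¬ p.Nil := fun hn => hl (by rw [SimpleGraph.Walk.length_eq_zero_iff.2 hn]; omega)
      refine .inr ⟨p.penultimate, ⟨p.dropLast, ?_⟩, p.adj_penultimate hn⟩
      have := p.length_dropLast_add_one hn
      omega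
  · rintro (⟨p, hp⟩ | ⟨j, ⟨p, hp⟩, hj⟩)
    · exact ⟨p, by omega⟩
    · exact ⟨p.concat hj, by simpa using hp⟩

theorem mem_ball_zero {V : Type*} {H : SimpleGraph V} {k i : V} : i ∈ ball H 0 k ↔ k = i := by
  constructor
  · rintro ⟨p, hp⟩
    exact SimpleGraph.Walk.eq_of_length_eq_zero (Nat.le_zero.1 hp)
  · rintro rfl
    exact ⟨.nil, le_rfl⟩

/-- Induction on the radius: the last intermediate node of a walk is transported by
`PairRel.extend`, which controls its relation to the root and to the endpoint simultaneously. -/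
theorem vertsAgree_ball (h : ℕ) :
    VertsAgree G₁ G₂ (fun k => ball G₁.graph h k) (fun k => ball G₂.graph h k) := by
  induction h with
  | zero => exact fun k i k' i' p => by simpa only [mem_ball_zero] using p.eq_iff
  | succ h ih =>
    intro k i k' i' p
    obtain ⟨e, he⟩ := p.extend
    simp only [mem_ball_succ]
    refine or_congr (ih p) (e.exists_congr fun j => ?_)
    exact and_congr (ih (he j).1) (he j).2.swap.adj_iff

theorem vertsAgree_bag (π : Policy) : VertsAgree G₁ G₂ (π.bag G₁).verts (π.bag G₂).verts := by
  cases π with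
  | nodeDeletion => exact fun _ _ _ _ p => not_congr p.swap.eq_iff
  | nodeMarking => exact fun _ _ _ _ _ => Iff.rfl
  | ego h => exact vertsAgree_ball h
  | egoPlus h => exact vertsAgree_ball h

theorem graphAgree_bag (π : Policy) : GraphAgree G₁ G₂ (π.bag G₁).graph (π.bag G₂).graph :=
  GraphAgree.restrict (vertsAgree_bag π)

open Classical in
theorem agree_mark : Agree G₁ G₂ (mark G₁.feat) (mark G₂.feat) := by
  intro k i k' i' p
  have h : (if i = k then (1 : ℝ) else 0) = if i' = k' then 1 else 0 := if_congr p.swap.eq_iff rfl rfl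
  simp only [mark, p.swap.feat_eq, h]

theorem agree_bag_feat (π : Policy) : Agree G₁ G₂ (π.bag G₁).feat (π.bag G₂).feat := by
  cases π with
  | nodeDeletion => exact fun _ _ _ _ p => p.swap.feat_eq
  | nodeMarking => exact agree_mark
  | ego h => exact fun _ _ _ _ p => p.swap.feat_eq
  | egoPlus h => exact agree_mark

/-! ### Stackings -/

/-- Reduces an invariant of a whole architecture to one layer, for two runs on different node types.
-/
theorem Stack.run_rel {L : ℕ → ℕ → Type} {S₁ S₂ : ℕ → Type*}
    {step₁ : ∀ {d e : ℕ}, L d e → S₁ d → S₁ e} {step₂ : ∀ {d e : ℕ}, L d e → S₂ d → S₂ e}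
    (C : ∀ {d : ℕ}, S₁ d → S₂ d → Prop)
    (hstep : ∀ {d e : ℕ} (l : L d e) {x₁ : S₁ d} {x₂ : S₂ d}, C x₁ x₂ → C (step₁ l x₁) (step₂ l x₂))
    {d e : ℕ} (T : Stack L d e) {x₁ : S₁ d} {x₂ : S₂ d} (h : C x₁ x₂) :
    C (Stack.run (S := S₁) step₁ T x₁) (Stack.run (S := S₂) step₂ T x₂) := by
  induction T with
  | nil => exact h
  | cons l rest ih => exact ih (hstep l h)

/-! ### Message passing -/

theorem mem_nbrs {V : Type*} [Fintype V] {H : SimpleGraph V} {i j : V} :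
    j ∈ nbrs H i ↔ H.Adj i j := by
  simp [nbrs]

theorem map_nbrs {H₁ : SimpleGraph V₁} {H₂ : SimpleGraph V₂} {i : V₁} {i' : V₂} (e : V₁ ≃ V₂)
    (h : ∀ j, H₁.Adj i j ↔ H₂.Adj i' (e j)) : (nbrs H₁ i).map e.toEmbedding = nbrs H₂ i' := by
  ext j
  rw [Finset.mem_map_equiv, mem_nbrs, mem_nbrs, h, e.apply_symm_apply]

/-- A single bijection matches the neighbours, and the features, of two related nodes in related
subgraphs. -/
theorem exists_nbrs_equiv {g₁ : V₁ → SimpleGraph V₁} {g₂ : V₂ → SimpleGraph V₂}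
    (hg : GraphAgree G₁ G₂ g₁ g₂) (p : PairRel G₁ G₂ k i k' i') :
    ∃ e : V₁ ≃ V₂, (∀ j, j ∈ nbrs (g₁ k) i ↔ e j ∈ nbrs (g₂ k') i') ∧
      ∀ j, PairRel G₁ G₂ k j k' (e j) := by
  obtain ⟨e, he⟩ := p.extend
  refine ⟨e, fun j => ?_, fun j => (he j).1⟩
  rw [mem_nbrs, mem_nbrs]
  exact hg p (he j).1 (he j).2

variable {m n : ℕ} {g₁ : V₁ → SimpleGraph V₁} {g₂ : V₂ → SimpleGraph V₂}
  {s₁ : V₁ → Set V₁} {s₂ : V₂ → Set V₂} {x₁ : V₁ → V₁ → Fin m → ℝ} {x₂ : V₂ → V₂ → Fin m → ℝ}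
  {y₁ : V₁ → Fin m → ℝ} {y₂ : V₂ → Fin m → ℝ}

theorem Agree.sum_nbrs (hg : GraphAgree G₁ G₂ g₁ g₂) (hx : Agree G₁ G₂ x₁ x₂) :
    Agree G₁ G₂ (fun k i => ∑ j ∈ nbrs (g₁ k) i, x₁ k j) (fun k i => ∑ j ∈ nbrs (g₂ k) i, x₂ k j) := by
  intro k i k' i' p
  obtain ⟨e, hmem, he⟩ := exists_nbrs_equiv hg p
  exact Finset.sum_equiv e hmem fun j _ => hx (he j)

theorem Agree.map_nbrs (hg : GraphAgree G₁ G₂ g₁ g₂) (hx : Agree G₁ G₂ x₁ x₂) :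
    Agree G₁ G₂ (fun k i => (nbrs (g₁ k) i).val.map (x₁ k))
      (fun k i => (nbrs (g₂ k) i).val.map (x₂ k)) := by
  intro k i k' i' p
  obtain ⟨e, hmem, he⟩ := exists_nbrs_equiv hg p
  have h := SubGNN.map_nbrs (H₁ := g₁ k) (H₂ := g₂ k') (i := i) (i' := i') e
    fun j => by simpa only [mem_nbrs] using hmem j
  simp only [← h, Finset.map_val, Multiset.map_map]
  exact Multiset.map_congr rfl fun j _ => hx (he j)

theorem Agree.mpLayer (hg : GraphAgree G₁ G₂ g₁ g₂) (l : MPLayer m n) (hx : Agree G₁ G₂ x₁ x₂) :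
    Agree G₁ G₂ (fun k => l.apply (g₁ k) (x₁ k)) (fun k => l.apply (g₂ k) (x₂ k)) := by
  intro k i k' i' p
  cases l with
  | morris σ W₁ W₂ =>
    have := hx.sum_nbrs hg p
    simp only at this
    simp only [MPLayer.apply, hx p, this]
  | general upd =>
    have := hx.map_nbrs hg p
    simp only at this
    simp only [MPLayer.apply, hx p, this]

/-- `Agree` compares features across different roots, so the induction must advance all subgraphs
together, layer by layer. -/
theorem siamese_cons {V : Type*} [Fintype V] {a b c : ℕ} (l : MPLayer a b) (γ : MPNN b c)
    (g : V → SimpleGraph V) (x : V → V → Fin a → ℝ) :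
    siamese (.cons l γ) g x = siamese γ g (fun k => l.apply (g k) (x k)) :=
  rfl

theorem Agree.siamese (hg : GraphAgree G₁ G₂ g₁ g₂) : ∀ {m n : ℕ} (γ : MPNN m n)
    {x₁ : V₁ → V₁ → Fin m → ℝ} {x₂ : V₂ → V₂ → Fin m → ℝ}, Agree G₁ G₂ x₁ x₂ →
      Agree G₁ G₂ (siamese γ g₁ x₁) (siamese γ g₂ x₂)
  | _, _, .nil, _, _, h => h
  | _, _, .cons l γ, _, _, h => by
    rw [siamese_cons, siamese_cons]
    exact Agree.siamese hg γ (h.mpLayer hg l)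

theorem NodeAgree.mpnn (γ : MPNN m n) (hy : NodeAgree G₁ G₂ y₁ y₂) :
    NodeAgree G₁ G₂ (γ.apply G₁.graph y₁) (γ.apply G₂.graph y₂) :=
  -- The original graph is treated as a bag that is constant in the root, and the result is read off
  -- the diagonal.
  (hy.agree_right.siamese graphAgree_const γ).diag

/-! ### Sums over the bag -/

theorem Scope.mem_iff (s : Scope) (hs : VertsAgree G₁ G₂ s₁ s₂) (p : PairRel G₁ G₂ k i k' i') :
    s.Mem s₁ k i ↔ s.Mem s₂ k' i' := by
  cases s
  · exact Iff.rfl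
  · exact hs p

theorem Agree.sumNodes (s : Scope) (hs : VertsAgree G₁ G₂ s₁ s₂) (hx : Agree G₁ G₂ x₁ x₂) :
    NodeAgree G₁ G₂ (sumNodes s s₁ x₁) (sumNodes s s₂ x₂) := by
  intro k k' p
  obtain ⟨e, he⟩ := p.extend
  refine Finset.sum_equiv e (fun i => ?_) fun i _ => hx (he i).1
  simpa using s.mem_iff hs (he i).1

theorem Agree.sumSubgraphs (s : Scope) (hs : VertsAgree G₁ G₂ s₁ s₂) (hx : Agree G₁ G₂ x₁ x₂) :
    NodeAgree G₁ G₂ (sumSubgraphs s s₁ x₁) (sumSubgraphs s s₂ x₂) := by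
  intro k k' p
  obtain ⟨e, he⟩ := p.extend
  -- The summation index is now the root, hence the swapped pairs.
  refine Finset.sum_equiv e (fun i => ?_) fun i _ => hx (he i).1.swap
  simpa using s.mem_iff hs (he i).1.swap

theorem NodeAgree.sum_univ {M : Type*} [AddCommMonoid M] {y₁ : V₁ → M} {y₂ : V₂ → M}
    (h : ¬ WLDistinguishes 3 G₁ G₂) (hy : NodeAgree G₁ G₂ y₁ y₂) : ∑ k, y₁ k = ∑ k, y₂ k := by
  obtain ⟨e, he⟩ := PairRel.exists_root_equiv h
  exact Fintype.sum_equiv e _ _ fun k => hy (he k)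

/-! ### Layers of the individual architectures -/

theorem Agree.dssLayer (s : Scope) (hs : VertsAgree G₁ G₂ s₁ s₂) (hg : GraphAgree G₁ G₂ g₁ g₂)
    (l : DSSLayer m n) (hx : Agree G₁ G₂ x₁ x₂) :
    Agree G₁ G₂ (l.apply s G₁.graph s₁ g₁ x₁) (l.apply s G₂.graph s₂ g₂ x₂) := by
  have hsum := hx.sumSubgraphs s hs
  intro k i k' i' p
  cases l with
  | separate γ₀ γ₁ =>
    exact congrArg₂ (· + ·) (hx.siamese hg γ₀ p) (hsum.mpnn γ₁ p.right)
  | fused σ W₁ W₂ U₁ U₂ =>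
    have h₁ := hx.sum_nbrs hg p
    have h₂ := hsum.agree_right.sum_nbrs graphAgree_const p
    simp only at h₁ h₂
    simp only [DSSLayer.apply, hx p, hsum p.right, h₁, h₂]

theorem Agree.akLayer (s : Scope) (hs : VertsAgree G₁ G₂ s₁ s₂) (hg : GraphAgree G₁ G₂ g₁ g₂)
    (l : AKLayer m n) (hx : Agree G₁ G₂ x₁ x₂) :
    Agree G₁ G₂ (l.apply s s₁ g₁ x₁) (l.apply s s₂ g₂ x₂) := by
  intro k i k' i' p
  cases l with
  | sum γ | concat γ =>
    have hγ := hx.siamese hg γ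
    -- The new feature of (k, i) depends on i alone, so only the diagonal pair at i matters.
    simp only [AKLayer.apply, hγ p.right, hγ.sumNodes s hs p.right]

theorem Agree.akCtxLayer (s : Scope) (hs : VertsAgree G₁ G₂ s₁ s₂) (hg : GraphAgree G₁ G₂ g₁ g₂)
    (l : AKCtxLayer m n) (hx : Agree G₁ G₂ x₁ x₂) :
    Agree G₁ G₂ (l.apply s s₁ g₁ x₁) (l.apply s s₂ g₂ x₂) := by
  intro k i k' i' p
  cases l with
  | sum γ | concat γ =>
    have hγ := hx.siamese hg γ
    simp only [AKCtxLayer.apply, hγ p.right, hγ.sumNodes s hs p.right,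
      hγ.sumSubgraphs s hs p.right]

open Classical in
theorem Agree.sum_nbrs_ne_root {M : Type*} [AddCommMonoid M] (hg : GraphAgree G₁ G₂ g₁ g₂)
    (hx : Agree G₁ G₂ x₁ x₂) (f : (Fin m → ℝ) → M) :
    Agree G₁ G₂ (fun k i => ∑ j ∈ (nbrs (g₁ k) i).filter (fun j => j ≠ k), f (x₁ k j))
      (fun k i => ∑ j ∈ (nbrs (g₂ k) i).filter (fun j => j ≠ k), f (x₂ k j)) := by
  intro k i k' i' p
  obtain ⟨e, hmem, he⟩ := exists_nbrs_equiv hg p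
  refine Finset.sum_equiv e (fun j => ?_) fun j _ => congrArg f (hx (he j))
  rw [Finset.mem_filter, Finset.mem_filter]
  exact and_congr (hmem j) (not_congr (he j).swap.eq_iff)

open Classical in
theorem Agree.idLayer (hg : GraphAgree G₁ G₂ g₁ g₂) (l : IDLayer m n) (hx : Agree G₁ G₂ x₁ x₂) :
    Agree G₁ G₂ (l.apply g₁ x₁) (l.apply g₂ x₂) := by
  intro k i k' i' p
  have hroot {e : ℕ} (z : Fin e → ℝ) :
      (if (g₁ k).Adj k i then z else 0) = if (g₂ k').Adj k' i' then z else 0 :=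
    -- Adjacency of root and node is the instance of `GraphAgree` at the degenerate triple (k, k,
    -- i).
    if_congr (hg p.left p p) rfl rfl
  cases l with
  | morris σ W₁ W₂ W₃ =>
    have h := hx.sum_nbrs_ne_root hg id p
    simp only [id] at h
    simp only [IDLayer.apply, hx p, hx p.left, hroot, h]
  | general upd μ₀ μ₁ =>
    have h := hx.sum_nbrs_ne_root hg μ₀ p
    simp only at h
    simp only [IDLayer.apply, hx p, hx p.left, hroot, h]

/-! ### Readouts and models -/

/-- Equivariant set layers already sum over all roots, so the global matching of roots is needed
inside each layer and not only at the final sum. -/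
theorem NodeAgree.deepSets {o : ℕ} (h : ¬ WLDistinguishes 3 G₁ G₂) (r : DeepSets m o)
    (hy : NodeAgree G₁ G₂ y₁ y₂) : r.eval y₁ = r.eval y₂ := by
  cases r with
  | early φ ψ =>
    have hφ : NodeAgree G₁ G₂ (fun k => φ.eval (y₁ k)) (fun k => φ.eval (y₂ k)) :=
      fun _ _ p => congrArg φ.eval (hy p)
    exact congrArg ψ.eval (hφ.sum_univ h)
  | late layers ψ =>
    refine congrArg ψ.eval (NodeAgree.sum_univ h ?_)
    refine Stack.run_rel (S₁ := fun d => V₁ → Fin d → ℝ) (S₂ := fun d => V₂ → Fin d → ℝ)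
      (fun y₁ y₂ => NodeAgree G₁ G₂ y₁ y₂) ?_ layers hy
    intro a b l z₁ z₂ hz k k' p
    have hW : NodeAgree G₁ G₂ (fun k => l.W₂ *ᵥ z₁ k) (fun k => l.W₂ *ᵥ z₂ k) :=
      fun _ _ p => congrArg (l.W₂ *ᵥ ·) (hz p)
    simp only [SetLayer.apply, hz p, hW.sum_univ h]

theorem Model.eval_eq {o : ℕ} (h : ¬ WLDistinguishes 3 G₁ G₂) (N : Model d o) :
    N.eval G₁ = N.eval G₂ := by
  have hds {e : ℕ} (π : Policy) (s : Scope) (S : MPNN (π.outDim d) e) (r : DeepSets e o) :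
      dsEval s (π.bag G₁) S r = dsEval s (π.bag G₂) S r :=
    (((agree_bag_feat π).siamese (graphAgree_bag π) S).sumNodes s (vertsAgree_bag π)).deepSets h r
  cases N with
  | reconstruction s S r => exact hds .nodeDeletion s S r
  | dsGNN π s S r => exact hds π s S r
  | gnnAK h' s S μ =>
    refine congrArg μ.eval (NodeAgree.sum_univ h (Agree.diag ?_))
    exact Stack.run_rel (S₁ := fun d => V₁ → V₁ → Fin d → ℝ) (S₂ := fun d => V₂ → V₂ → Fin d → ℝ)
      (fun x₁ x₂ => Agree G₁ G₂ x₁ x₂)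
      (fun l _ _ hx => hx.akLayer s (vertsAgree_bag _) (graphAgree_bag _) l) S (agree_bag_feat _)
  | gnnAKCtx h' s S μ =>
    refine congrArg μ.eval (NodeAgree.sum_univ h (Agree.diag ?_))
    exact Stack.run_rel (S₁ := fun d => V₁ → V₁ → Fin d → ℝ) (S₂ := fun d => V₂ → V₂ → Fin d → ℝ)
      (fun x₁ x₂ => Agree G₁ G₂ x₁ x₂)
      (fun l _ _ hx => hx.akCtxLayer s (vertsAgree_bag _) (graphAgree_bag _) l) S (agree_bag_feat _)
  | ngnn h' s S γ μ =>
    refine congrArg μ.eval (NodeAgree.sum_univ h (NodeAgree.mpnn γ ?_))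
    exact ((agree_bag_feat _).siamese (graphAgree_bag _) S).sumNodes s (vertsAgree_bag _)
  | idGNN h' S μ =>
    refine congrArg μ.eval (NodeAgree.sum_univ h (Agree.diag ?_))
    exact Stack.run_rel (S₁ := fun d => V₁ → V₁ → Fin d → ℝ) (S₂ := fun d => V₂ → V₂ → Fin d → ℝ)
      (fun x₁ x₂ => Agree G₁ G₂ x₁ x₂)
      (fun l _ _ hx => hx.idLayer (graphAgree_bag _) l) S (agree_bag_feat _)
  | dssGNN π s S r =>
    refine NodeAgree.deepSets h r (Agree.sumNodes s (vertsAgree_bag π) ?_)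
    exact Stack.run_rel (S₁ := fun d => V₁ → V₁ → Fin d → ℝ) (S₂ := fun d => V₂ → V₂ → Fin d → ℝ)
      (fun x₁ x₂ => Agree G₁ G₂ x₁ x₂)
      (fun l _ _ hx => hx.dssLayer s (vertsAgree_bag π) (graphAgree_bag π) l) S (agree_bag_feat π)

end Bisimulation

end SubGNN

theorem corollary1 {V₁ V₂ : Type*} [Fintype V₁] [Fintype V₂] {d o : ℕ}
    (G₁ : SubGNN.AttrGraph V₁ d) (G₂ : SubGNN.AttrGraph V₂ d)
    (hG : ¬ G₁.Isomorphic G₂)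
    (N : SubGNN.Model d o) (hN : N.Distinguishes G₁ G₂) :
    SubGNN.WLDistinguishes 3 G₁ G₂ :=
  by_contra fun h => hN (N.eval_eq h)
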